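/- Let $N\ge 1$ be an integer and let $\vec C_N$ be the directed cycle with vertices $0,\dots,N-1$ and arcs $(k,k+1)$ (indices modulo $N$). Call a tournament $T_N$ on $\{0,\dots,N-1\}$ a request tournament if its arcs are all the $(i,i+q)$ with $0\le i\le N-1$ and $1\le q\le \frac{N-1}{2}$ and, when $N$ is even, in addition exactly one of the two arcs $(i,i+\frac N2)$, $(i+\frac N2,i)$ for each $0\le i\le \frac N2-1$. Each arc $(i,j)$ of $T_N$ is routed along the directed path from $i$ to $j$ in $\vec C_N$, and for a digraph $B$ formed by arcs of $T_N$ the load $L(B,e)$ of an arc $e$ of $\vec C_N$ is the number of arcs of $B$ routed through $e$. For a positive integer $C$, let $A(C,N)$ be the minimum of $\sum_{\omega=1}^{W}|V(B_\omega)|$ over all request tournaments $T_N$ and all partitions of the arcs of $T_N$ into digraphs $B_1,\dots,B_W$ such that $L(B_\omega,e)\le C$ for every $\omega$ and every arc $e$ of $\vec C_N$. Then: (i) if $N\equiv 0$ or $4\pmod{12}$, then $A(3,N)=\frac{N^2}{4}$; (ii) if $N\equiv 1$ or $5\pmod{12}$, then $A(3,N)=\frac{N(N-1)}{4}$. -/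

import Mathlib

namespace RingGrooming

/-- The distance from `i` to `j` in the unidirectional cycle on the vertices `0, …, N - 1`, whose
arcs are `(k, k + 1)` with indices modulo `N`. -/
def dist {N : ℕ} (i j : Fin N) : ℕ := (j.val + N - i.val) % N

/-- The vertex `i + t` (modulo `N`) of the cycle. -/
def step {N : ℕ} (i : Fin N) (t : ℕ) : Fin N :=
  ⟨(i.val + t) % N, Nat.mod_lt _ i.pos⟩

/-- The arcs of the dipath of the cycle along which the request `r = (i, j)` is routed:
`(i, i + 1), (i + 1, i + 2), …, (j - 1, j)`. -/
def route {N : ℕ} (r : Fin N × Fin N) : Finset (Fin N × Fin N) :=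
  (Finset.range (dist r.1 r.2)).image fun t => (step r.1 t, step r.1 (t + 1))

/-- The set of arcs of the unidirectional cycle. -/
def ringArcs (N : ℕ) : Finset (Fin N × Fin N) :=
  Finset.univ.image fun i => (i, step i 1)

/-- The requests form a tournament `T_N` of the problem: all arcs `(i, i + q)` with `1 ≤ q` and
`2 * q < N`, and, when `N` is even, exactly one arc out of `(i, i + N/2)` and `(i + N/2, i)` for
each pair of opposite vertices; no other arcs. -/
structure IsRequestTournament {N : ℕ} (T : Finset (Fin N × Fin N)) : Prop where
  ne_of_mem : ∀ i j, (i, j) ∈ T → i ≠ j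
  two_mul_dist_le : ∀ i j, (i, j) ∈ T → 2 * dist i j ≤ N
  mem_of_short : ∀ i j, i ≠ j → 2 * dist i j < N → (i, j) ∈ T
  mem_of_opposite : ∀ i j, i ≠ j → 2 * dist i j = N → ((i, j) ∈ T ↔ (j, i) ∉ T)

/-- A digraph whose vertices are among the vertices of the cycle. -/
structure RequestDigraph (N : ℕ) where
  verts : Finset (Fin N)
  arcs : Finset (Fin N × Fin N)
  incidence : ∀ r ∈ arcs, r.1 ∈ verts ∧ r.2 ∈ verts

/-- The load of the arc `e` of the cycle: the number of requests of `B` routed through `e`. -/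
def load {N : ℕ} (B : RequestDigraph N) (e : Fin N × Fin N) : ℕ :=
  (B.arcs.filter fun r => e ∈ route r).card

/-- The load constraint for the grooming factor `C`. -/
def Admissible {N : ℕ} (C : ℕ) (B : RequestDigraph N) : Prop :=
  ∀ e ∈ ringArcs N, load B e ≤ C

/-- The digraphs `B ω` are admissible and their arc sets partition `T`. -/
structure IsValidPartition {N : ℕ} (C : ℕ) (T : Finset (Fin N × Fin N)) {W : ℕ}
    (B : Fin W → RequestDigraph N) : Prop where
  arcs_subset : ∀ ω, (B ω).arcs ⊆ T
  existsUnique_mem : ∀ r ∈ T, ∃! ω, r ∈ (B ω).arcs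
  admissible : ∀ ω, Admissible C (B ω)

/-- The values of the objective function `∑ ω, |V (B ω)|`, over all choices of the tournament
(that is, of the arcs joining opposite vertices, when `N` is even) and over all of its valid
partitions. -/
def costs (C N : ℕ) : Set ℕ :=
  {a | ∃ T : Finset (Fin N × Fin N), IsRequestTournament T ∧
    ∃ (W : ℕ) (B : Fin W → RequestDigraph N), IsValidPartition C T B ∧
      a = ∑ ω, (B ω).verts.card}

/-- `A(C, N)`: the minimum of the objective function (a genuine minimum for `1 ≤ C`,
see `isLeast_A`). -/
noncomputable def A (C N : ℕ) : ℕ := sInf (costs C N)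

theorem dist_add_dist {N : ℕ} {i j : Fin N} (h : i ≠ j) : dist i j + dist j i = N := by
  have h' : i.val ≠ j.val := fun e => h (Fin.ext e)
  have hi := i.isLt
  have hj := j.isLt
  unfold dist
  rcases lt_or_gt_of_ne h' with hlt | hlt
  · rw [show j.val + N - i.val = (j.val - i.val) + N by omega, Nat.add_mod_right,
      Nat.mod_eq_of_lt (by omega), Nat.mod_eq_of_lt (by omega)]
    omega
  · rw [show i.val + N - j.val = (i.val - j.val) + N by omega, Nat.add_mod_right,
      Nat.mod_eq_of_lt (by omega), Nat.mod_eq_of_lt (by omega)]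
    omega

theorem costs_nonempty {C : ℕ} (hC : 1 ≤ C) (N : ℕ) : (costs C N).Nonempty := by
  classical
  let T : Finset (Fin N × Fin N) := Finset.univ.filter fun r =>
    r.1 ≠ r.2 ∧ (2 * dist r.1 r.2 < N ∨ (2 * dist r.1 r.2 = N ∧ r.1 < r.2))
  have hT : IsRequestTournament T := by
    refine ⟨fun i j h => ?_, fun i j h => ?_, fun i j hne h => ?_, fun i j hne h => ?_⟩
    · simp only [T, Finset.mem_filter] at h
      exact h.2.1
    · simp only [T, Finset.mem_filter] at h
      omega
    · simp [T, hne, h]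
    · have hs := dist_add_dist hne
      have h2 : 2 * dist j i = N := by omega
      simp only [T, Finset.mem_filter, Finset.mem_univ, true_and, h, h2, lt_irrefl, false_or]
      simp only [hne, hne.symm, ne_eq, not_false_eq_true, true_and, not_lt]
      exact ⟨le_of_lt, fun hle => lt_of_le_of_ne hle hne⟩
  refine ⟨_, T, hT, T.card, fun ω => ⟨{(T.equivFin.symm ω).1.1, (T.equivFin.symm ω).1.2},
    {(T.equivFin.symm ω).1}, by simp⟩, ⟨?_, ?_, ?_⟩, rfl⟩
  · intro ω
    simp
  · intro r hr
    refine ⟨T.equivFin ⟨r, hr⟩, by simp, fun ω hω => ?_⟩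
    have hω' : r = (T.equivFin.symm ω).1 := by simpa using hω
    rw [← Equiv.symm_apply_eq]
    exact Subtype.ext hω'.symm
  · intro ω e _
    exact (Finset.card_filter_le _ _).trans (by simpa using hC)

theorem isLeast_A {C : ℕ} (hC : 1 ≤ C) (N : ℕ) : IsLeast (costs C N) (A C N) :=
  ⟨Nat.sInf_mem (costs_nonempty hC N), fun _ h => Nat.sInf_le h⟩

end RingGrooming

/-!
The cost is determined by a lower bound on each part of a partition and a construction from Steiner
triple systems that attains it.

*Lower bound.* Let `B` be a loopless digraph of load at most `3`. At each vertex, the number of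
arcs leaving it (or entering it) plus the number of arcs passing over it is at most `3`. A vertex of
degree at least `5` therefore has three outgoing or three incoming arcs, and over its nearest
out-neighbour (or in-neighbour) pass the two other ones, so that this neighbour has degree at
most `2`. This matching is injective (`card_five_le_deg_le`), and it follows that the sum of
`deg v + deg v % 2` over all vertices is at most `4 * |V(B)|` (`sum_deg_add_mod_two_le`). In the
tournament every vertex has degree `N - 1`, so summing over the parts gives
`N * (N - 1 + (N - 1) % 2) ≤ 4 * cost` (`mul_le_four_mul_cost`): when `N` is even, each vertex has
odd degree in at least one part.

*Construction.* Write `N = 2 * m` or `N = 2 * m + 1`. Group the vertices of the ring into `m` pairs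
`{y, y + m}`, the classes `1, …, m`, and a class `0` that holds the remaining vertex when `N` is odd
and is empty when `N` is even. For two nonzero classes `p < q`, the four arcs between them,
`p → q → p + m → q + m → p`, go exactly once around the ring; so do the arcs among the vertices of
the classes `0` and `p` when `N` is odd, and when `N` is even there is only one such arc,
`p → p + m`. Hence the arcs assigned to a pair of classes have load at most `1`
(`eq_of_pair_eq`), and the arcs assigned to the three pairs in a triple of classes have load at most
`3`. In the congruence classes considered, `m + 1` is `1` or `3` modulo `6`, so the `m + 1` classes
carry a Steiner triple system (`exists_isSteinerTripleSystem`, by the constructions of Bose and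
Skolem), whose triples partition the pairs. Each class lies in `m / 2` triples, so the cost is
`N * m / 2` (`exists_mem_costs`), which equals the lower bound.
-/

namespace RingGrooming

/-! ### Distances on the ring -/

theorem dist_eq_ite {N : ℕ} (i j : Fin N) :
    dist i j = if i.val ≤ j.val then j.val - i.val else j.val + N - i.val := by
  have hi := i.isLt
  have hj := j.isLt
  unfold dist
  split_ifs with h
  · rw [show j.val + N - i.val = (j.val - i.val) + N by omega, Nat.add_mod_right,
      Nat.mod_eq_of_lt (by omega)]
  · exact Nat.mod_eq_of_lt (by omega)

theorem dist_lt {N : ℕ} (i j : Fin N) : dist i j < N := Nat.mod_lt _ i.pos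

theorem val_step {N : ℕ} (i : Fin N) {t : ℕ} (ht : t ≤ N) :
    (step i t).val = if i.val + t < N then i.val + t else i.val + t - N := by
  have hi := i.isLt
  simp only [step]
  split_ifs with h
  · exact Nat.mod_eq_of_lt h
  · rw [Nat.mod_eq_sub_mod (by omega), Nat.mod_eq_of_lt (by omega)]

theorem step_dist {N : ℕ} (i j : Fin N) : step i (dist i j) = j := by
  have h := val_step i (dist_lt i j).le
  have h' := dist_eq_ite i j
  ext
  rw [h]
  split_ifs at * <;> omega

theorem dist_step {N : ℕ} (i : Fin N) {t : ℕ} (ht : t < N) : dist i (step i t) = t := by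
  have h := val_step i ht.le
  have h' := dist_eq_ite i (step i t)
  split_ifs at * <;> omega

theorem dist_right_injective {N : ℕ} (i : Fin N) : Function.Injective (dist i) := fun j k h => by
  rw [← step_dist i j, h, step_dist]

theorem dist_left_injective {N : ℕ} (j : Fin N) : Function.Injective fun i => dist i j := by
  intro i k h
  have h1 := dist_eq_ite i j
  have h2 := dist_eq_ite k j
  simp only at h
  ext
  split_ifs at * <;> omega

theorem dist_lt_dist_of_dist_lt {N : ℕ} {u v x : Fin N} (huv : u ≠ v) (h : dist u v < dist x v) :
    x ≠ u ∧ dist x u < dist x v := by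
  refine ⟨fun e => absurd h (by simp [e]), ?_⟩
  have huv' : u.val ≠ v.val := fun e => huv (Fin.ext e)
  have h1 := dist_eq_ite u v
  have h2 := dist_eq_ite x v
  have h3 := dist_eq_ite x u
  split_ifs at * <;> omega

theorem mem_route_of_dist_lt {N : ℕ} {r : Fin N × Fin N} {w : Fin N}
    (h : dist r.1 w < dist r.1 r.2) : (w, step w 1) ∈ route r := by
  refine Finset.mem_image.2 ⟨dist r.1 w, Finset.mem_range.2 h, ?_⟩
  have hN := dist_lt r.1 r.2
  have h1 := val_step w (t := 1) (by omega)
  have h2 := val_step r.1 (t := dist r.1 w + 1) (by omega)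
  have h3 := dist_eq_ite r.1 w
  rw [step_dist]
  congr 1
  ext
  split_ifs at * <;> omega

theorem mem_route_of_dist_le {N : ℕ} {r : Fin N × Fin N} {w : Fin N} (hw : r.1 ≠ w)
    (h : dist r.1 w ≤ dist r.1 r.2) : (step w (N - 1), w) ∈ route r := by
  have hw' : r.1.val ≠ w.val := fun e => hw (Fin.ext e)
  have hN := dist_lt r.1 r.2
  have h3 := dist_eq_ite r.1 w
  have hpos : 0 < dist r.1 w := by split_ifs at * <;> omega
  refine Finset.mem_image.2 ⟨dist r.1 w - 1, Finset.mem_range.2 (by omega), ?_⟩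
  have h1 := val_step w (t := N - 1) (by omega)
  have h2 := val_step r.1 (t := dist r.1 w - 1) (by omega)
  rw [Nat.sub_add_cancel hpos, step_dist]
  congr 1
  ext
  split_ifs at * <;> omega

theorem dist_lt_of_mem_route {N : ℕ} {r : Fin N × Fin N} {k : Fin N} {e : Fin N}
    (h : (k, e) ∈ route r) : dist r.1 k < dist r.1 r.2 := by
  obtain ⟨t, ht, hte⟩ := Finset.mem_image.1 h
  have hN := dist_lt r.1 r.2
  rw [Finset.mem_range] at ht
  rw [show k = step r.1 t from (congrArg Prod.fst hte).symm, dist_step _ (by omega)]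
  exact ht

/-! ### Degrees in digraphs of load at most three -/

/-- The arcs of `A` that leave the vertex `v`. -/
def outArcs {N : ℕ} (A : Finset (Fin N × Fin N)) (v : Fin N) : Finset (Fin N × Fin N) :=
  A.filter fun r => r.1 = v

/-- The arcs of `A` that enter the vertex `v`. -/
def inArcs {N : ℕ} (A : Finset (Fin N × Fin N)) (v : Fin N) : Finset (Fin N × Fin N) :=
  A.filter fun r => r.2 = v

/-- The arcs of `A` whose route has `v` as an interior vertex. -/
def passArcs {N : ℕ} (A : Finset (Fin N × Fin N)) (v : Fin N) : Finset (Fin N × Fin N) :=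
  A.filter fun r => r.1 ≠ v ∧ dist r.1 v < dist r.1 r.2

/-- The total degree of `v` in the digraph with arc set `A`. -/
def deg {N : ℕ} (A : Finset (Fin N × Fin N)) (v : Fin N) : ℕ :=
  (outArcs A v).card + (inArcs A v).card

theorem dist_self {N : ℕ} (i : Fin N) : dist i i = 0 := by simp [dist_eq_ite]

theorem dist_pos {N : ℕ} {i j : Fin N} (h : i ≠ j) : 0 < dist i j := by
  rw [Nat.pos_iff_ne_zero]
  intro h0
  exact h (dist_right_injective i (by rw [h0, dist_self]))

section Load

variable {N : ℕ} {B : RequestDigraph N}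

/-- The arcs leaving `v` or passing over `v` all use the arc of the ring that leaves `v`. -/
theorem card_outArcs_add_card_passArcs_le {C : ℕ} (hB : Admissible C B)
    (hne : ∀ r ∈ B.arcs, r.1 ≠ r.2) (v : Fin N) :
    (outArcs B.arcs v).card + (passArcs B.arcs v).card ≤ C := by
  rw [← Finset.card_union_of_disjoint]
  · refine (Finset.card_le_card fun r hr => ?_).trans
      (hB (v, step v 1) (Finset.mem_image_of_mem _ (Finset.mem_univ v)))
    simp only [outArcs, passArcs, Finset.mem_union, Finset.mem_filter] at hr ⊢
    rcases hr with ⟨hr, rfl⟩ | ⟨hr, -, h⟩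
    · exact ⟨hr, mem_route_of_dist_lt (by rw [dist_self]; exact dist_pos (hne r hr))⟩
    · exact ⟨hr, mem_route_of_dist_lt h⟩
  · rw [Finset.disjoint_left]
    intro r h1 h2
    exact (Finset.mem_filter.1 h2).2.1 (Finset.mem_filter.1 h1).2

/-- The arcs entering `v` or passing over `v` all use the arc of the ring that enters `v`. -/
theorem card_inArcs_add_card_passArcs_le {C : ℕ} (hB : Admissible C B)
    (hne : ∀ r ∈ B.arcs, r.1 ≠ r.2) (v : Fin N) :
    (inArcs B.arcs v).card + (passArcs B.arcs v).card ≤ C := by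
  have hmem : (step v (N - 1), v) ∈ ringArcs N := by
    refine Finset.mem_image.2 ⟨step v (N - 1), Finset.mem_univ _, ?_⟩
    have hv := v.isLt
    have h1 := val_step v (t := N - 1) (by omega)
    have h2 := val_step (step v (N - 1)) (t := 1) (by omega)
    congr 1
    ext
    split_ifs at * <;> omega
  rw [← Finset.card_union_of_disjoint]
  · refine (Finset.card_le_card fun r hr => ?_).trans (hB _ hmem)
    simp only [inArcs, passArcs, Finset.mem_union, Finset.mem_filter] at hr ⊢
    rcases hr with ⟨hr, rfl⟩ | ⟨hr, hv, h⟩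
    · exact ⟨hr, mem_route_of_dist_le (hne r hr) le_rfl⟩
    · exact ⟨hr, mem_route_of_dist_le hv h.le⟩
  · rw [Finset.disjoint_left]
    intro r h1 h2
    rw [inArcs, Finset.mem_filter] at h1
    rw [passArcs, Finset.mem_filter, h1.2] at h2
    exact lt_irrefl _ h2.2.2

/-- If `w` is the nearest out-neighbour of `v`, the other arcs leaving `v` pass over `w`. -/
theorem exists_nearest_out (A : Finset (Fin N × Fin N)) (hne : ∀ r ∈ A, r.1 ≠ r.2) {v : Fin N}
    (h : 0 < (outArcs A v).card) :
    ∃ w, (v, w) ∈ A ∧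
      (outArcs A v).card ≤ ((passArcs A w).filter fun r => r.1 = v).card + 1 := by
  obtain ⟨⟨v', w⟩, h0, hmin⟩ := Finset.exists_min_image (outArcs A v) (fun r => dist v r.2)
    (Finset.card_pos.1 h)
  obtain ⟨h0A, rfl⟩ := Finset.mem_filter.1 h0
  refine ⟨w, h0A, ?_⟩
  rw [← Finset.card_erase_add_one h0]
  refine Nat.add_le_add_right (Finset.card_le_card fun r hr => ?_) 1
  obtain ⟨hr0, hr⟩ := Finset.mem_erase.1 hr
  have hle := hmin r hr
  obtain ⟨hrA, hrv⟩ := Finset.mem_filter.1 hr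
  refine Finset.mem_filter.2 ⟨Finset.mem_filter.2 ⟨hrA, ?_, ?_⟩, hrv⟩
  · rw [hrv]
    exact hne _ h0A
  · rw [hrv]
    refine lt_of_le_of_ne hle fun e => hr0 ?_
    exact Prod.ext hrv (dist_right_injective _ e).symm

/-- If `w` is the nearest in-neighbour of `v`, the other arcs entering `v` pass over `w`. -/
theorem exists_nearest_in (A : Finset (Fin N × Fin N)) (hne : ∀ r ∈ A, r.1 ≠ r.2) {v : Fin N}
    (h : 0 < (inArcs A v).card) :
    ∃ w, (w, v) ∈ A ∧
      (inArcs A v).card ≤ ((passArcs A w).filter fun r => r.2 = v).card + 1 := by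
  obtain ⟨⟨w, v'⟩, h0, hmin⟩ := Finset.exists_min_image (inArcs A v) (fun r => dist r.1 v)
    (Finset.card_pos.1 h)
  obtain ⟨h0A, rfl⟩ := Finset.mem_filter.1 h0
  refine ⟨w, h0A, ?_⟩
  rw [← Finset.card_erase_add_one h0]
  refine Nat.add_le_add_right (Finset.card_le_card fun r hr => ?_) 1
  obtain ⟨hr0, hr⟩ := Finset.mem_erase.1 hr
  have hle := hmin r hr
  obtain ⟨hrA, hrv⟩ := Finset.mem_filter.1 hr
  have hlt : dist w v' < dist r.1 v' := by
    refine lt_of_le_of_ne hle fun e => hr0 ?_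
    exact Prod.ext (dist_left_injective v' e).symm hrv
  refine Finset.mem_filter.2 ⟨Finset.mem_filter.2 ⟨hrA, ?_⟩, hrv⟩
  rw [hrv]
  exact dist_lt_dist_of_dist_lt (hne _ h0A) hlt

/-- When the load is at most `3`, vertices of degree at least `5` are no more numerous than vertices
of degree at most `2`: a vertex with three outgoing (or incoming) arcs is matched with its
nearest out-neighbour (or in-neighbour), over which the two other arcs pass. -/
theorem card_five_le_deg_le (hB : Admissible 3 B) (hne : ∀ r ∈ B.arcs, r.1 ≠ r.2) :
    (B.verts.filter fun v => 5 ≤ deg B.arcs v).card ≤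
      (B.verts.filter fun v => deg B.arcs v ≤ 2).card := by
  have hout := card_outArcs_add_card_passArcs_le hB hne
  have hin := card_inArcs_add_card_passArcs_le hB hne
  have key : ∀ v, 5 ≤ deg B.arcs v → ∃ w,
      ((v, w) ∈ B.arcs ∧ 2 ≤ ((passArcs B.arcs w).filter fun r => r.1 = v).card) ∨
      ((w, v) ∈ B.arcs ∧ 2 ≤ ((passArcs B.arcs w).filter fun r => r.2 = v).card) := by
    intro v hv
    unfold deg at hv
    have h1 := hout v
    have h2 := hin v
    rcases Nat.lt_or_ge 2 (outArcs B.arcs v).card with h | h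
    · obtain ⟨w, hw, hc⟩ := exists_nearest_out B.arcs hne (v := v) (by omega)
      exact ⟨w, Or.inl ⟨hw, by omega⟩⟩
    · obtain ⟨w, hw, hc⟩ := exists_nearest_in B.arcs hne (v := v) (by omega)
      exact ⟨w, Or.inr ⟨hw, by omega⟩⟩
  choose! φ hφ using key
  have hcard1 : ∀ w v, ((passArcs B.arcs w).filter fun r => r.1 = v).card ≤
      (passArcs B.arcs w).card := fun w v => Finset.card_filter_le _ _
  have hcard2 : ∀ w v, ((passArcs B.arcs w).filter fun r => r.2 = v).card ≤
      (passArcs B.arcs w).card := fun w v => Finset.card_filter_le _ _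
  have hmemout : ∀ {v w}, (v, w) ∈ B.arcs → (v, w) ∈ outArcs B.arcs v := fun h =>
    Finset.mem_filter.2 ⟨h, rfl⟩
  have hmemin : ∀ {v w}, (v, w) ∈ B.arcs → (v, w) ∈ inArcs B.arcs w := fun h =>
    Finset.mem_filter.2 ⟨h, rfl⟩
  -- An arc `(v, w)` and an arc `(w, v')` cannot both come from the matching: the two arcs passing
  -- over `w` would both be `(v, v')`.
  have mixed : ∀ v v' w, (v, w) ∈ B.arcs →
      2 ≤ ((passArcs B.arcs w).filter fun r => r.1 = v).card →
      2 ≤ ((passArcs B.arcs w).filter fun r => r.2 = v').card → False := by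
    intro v v' w hvw h1 h2
    have h3 : 0 < (inArcs B.arcs w).card := Finset.card_pos.2 ⟨_, hmemin hvw⟩
    have h4 := hin w
    have e1 := Finset.eq_of_subset_of_card_le
      (Finset.filter_subset (fun r => r.1 = v) (passArcs B.arcs w)) (by omega)
    have e2 := Finset.eq_of_subset_of_card_le
      (Finset.filter_subset (fun r => r.2 = v') (passArcs B.arcs w)) (by omega)
    have hsub : passArcs B.arcs w ⊆ {(v, v')} := fun r hr => by
      rw [Finset.mem_singleton]
      exact Prod.ext (Finset.filter_eq_self.1 e1 r hr) (Finset.filter_eq_self.1 e2 r hr)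
    have h5 := Finset.card_le_card hsub
    have h6 := hcard1 w v
    rw [Finset.card_singleton] at h5
    omega
  refine Finset.card_le_card_of_injOn φ ?_ ?_
  · intro v hv
    have hv' := (Finset.mem_filter.1 hv).2
    refine Finset.mem_filter.2 ⟨?_, ?_⟩
    · rcases hφ v hv' with ⟨h, -⟩ | ⟨h, -⟩
      · exact (B.incidence _ h).2
      · exact (B.incidence _ h).1
    · have h1 := hout (φ v)
      have h2 := hin (φ v)
      have h3 := hcard1 (φ v) v
      have h4 := hcard2 (φ v) v
      unfold deg
      rcases hφ v hv' with ⟨-, h⟩ | ⟨-, h⟩ <;> omega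
  · intro v hv v' hv' heq
    have h := hφ v (Finset.mem_filter.1 hv).2
    have h' := hφ v' (Finset.mem_filter.1 hv').2
    rw [← heq] at h'
    have h1 := hout (φ v)
    have h2 := hin (φ v)
    rcases h with ⟨ha, hc⟩ | ⟨ha, hc⟩ <;> rcases h' with ⟨ha', hc'⟩ | ⟨ha', hc'⟩
    · have h3 := hcard1 (φ v) v
      exact congrArg Prod.fst
        (Finset.card_le_one.1 (by omega) _ (hmemin ha) _ (hmemin ha'))
    · exact (mixed _ _ _ ha hc hc').elim
    · exact (mixed _ _ _ ha' hc' hc).elim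
    · have h3 := hcard2 (φ v) v
      exact congrArg Prod.snd
        (Finset.card_le_one.1 (by omega) _ (hmemout ha) _ (hmemout ha'))

/-- If a digraph of load at most `3` has `p` vertices, `q` arcs and `s` vertices of odd degree, then
`2 * q + s ≤ 4 * p`. -/
theorem sum_deg_add_mod_two_le (hB : Admissible 3 B) (hne : ∀ r ∈ B.arcs, r.1 ≠ r.2) :
    ∑ v, (deg B.arcs v + deg B.arcs v % 2) ≤ 4 * B.verts.card := by
  have hzero : ∀ v ∉ B.verts, deg B.arcs v = 0 := by
    intro v hv
    have h1 : outArcs B.arcs v = ∅ := Finset.filter_eq_empty_iff.2 fun r hr e =>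
      hv (e ▸ (B.incidence r hr).1)
    have h2 : inArcs B.arcs v = ∅ := Finset.filter_eq_empty_iff.2 fun r hr e =>
      hv (e ▸ (B.incidence r hr).2)
    simp [deg, h1, h2]
  rw [← Finset.sum_subset (Finset.subset_univ B.verts) fun v _ hv => by simp [hzero v hv]]
  have hpt : ∀ v ∈ B.verts, deg B.arcs v + deg B.arcs v % 2 +
      2 * (if deg B.arcs v ≤ 2 then 1 else 0) ≤ 4 + 2 * (if 5 ≤ deg B.arcs v then 1 else 0) := by
    intro v _
    have h1 := card_outArcs_add_card_passArcs_le hB hne v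
    have h2 := card_inArcs_add_card_passArcs_le hB hne v
    have h3 : deg B.arcs v ≤ 6 := by unfold deg; omega
    split_ifs <;> omega
  have hsum := Finset.sum_le_sum hpt
  simp only [Finset.sum_add_distrib, ← Finset.mul_sum, ← Finset.card_filter, Finset.sum_const,
    smul_eq_mul] at hsum
  rw [Finset.sum_add_distrib]
  have := card_five_le_deg_le hB hne
  omega

end Load

/-! ### The lower bound -/

theorem IsRequestTournament.mem_iff_swap_notMem {N : ℕ} {T : Finset (Fin N × Fin N)}
    (hT : IsRequestTournament T) {i j : Fin N} (h : i ≠ j) : (i, j) ∈ T ↔ (j, i) ∉ T := by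
  have hs := dist_add_dist h
  rcases lt_trichotomy (2 * dist i j) N with hlt | heq | hgt
  · refine iff_of_true (hT.mem_of_short i j h hlt) fun h' => ?_
    have := hT.two_mul_dist_le j i h'
    omega
  · exact hT.mem_of_opposite i j h heq
  · refine iff_of_false (fun h' => ?_) (not_not.2 (hT.mem_of_short j i h.symm (by omega)))
    have := hT.two_mul_dist_le i j h'
    omega

theorem IsRequestTournament.deg_eq {N : ℕ} {T : Finset (Fin N × Fin N)}
    (hT : IsRequestTournament T) (v : Fin N) : deg T v = N - 1 := by
  have h1 : (outArcs T v).card = (Finset.univ.filter fun u => (v, u) ∈ T).card := by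
    refine Finset.card_bij (fun r _ => r.2) ?_ ?_ ?_
    · rintro ⟨a, b⟩ h
      obtain ⟨hT', rfl⟩ := Finset.mem_filter.1 h
      exact Finset.mem_filter.2 ⟨Finset.mem_univ _, hT'⟩
    · rintro ⟨a, b⟩ h ⟨a', b'⟩ h' e
      exact Prod.ext ((Finset.mem_filter.1 h).2.trans (Finset.mem_filter.1 h').2.symm) e
    · intro u hu
      exact ⟨(v, u), Finset.mem_filter.2 ⟨(Finset.mem_filter.1 hu).2, rfl⟩, rfl⟩
  have h2 : (inArcs T v).card = (Finset.univ.filter fun u => (u, v) ∈ T).card := by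
    refine Finset.card_bij (fun r _ => r.1) ?_ ?_ ?_
    · rintro ⟨a, b⟩ h
      obtain ⟨hT', rfl⟩ := Finset.mem_filter.1 h
      exact Finset.mem_filter.2 ⟨Finset.mem_univ _, hT'⟩
    · rintro ⟨a, b⟩ h ⟨a', b'⟩ h' e
      exact Prod.ext e ((Finset.mem_filter.1 h).2.trans (Finset.mem_filter.1 h').2.symm)
    · intro u hu
      exact ⟨(u, v), Finset.mem_filter.2 ⟨(Finset.mem_filter.1 hu).2, rfl⟩, rfl⟩
  rw [deg, h1, h2, ← Finset.card_union_of_disjoint]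
  · have : (Finset.univ.filter fun u => (v, u) ∈ T) ∪ (Finset.univ.filter fun u => (u, v) ∈ T) =
        Finset.univ.erase v := by
      ext u
      simp only [Finset.mem_union, Finset.mem_filter, Finset.mem_univ, true_and,
        Finset.mem_erase, and_true]
      constructor
      · rintro (h | h)
        · exact (hT.ne_of_mem _ _ h).symm
        · exact hT.ne_of_mem _ _ h
      · intro h
        have := hT.mem_iff_swap_notMem h
        tauto
    rw [this, Finset.card_erase_of_mem (Finset.mem_univ v), Finset.card_univ, Fintype.card_fin]
  · rw [Finset.disjoint_left]
    intro u h1 h2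
    have h1 := (Finset.mem_filter.1 h1).2
    exact (hT.mem_iff_swap_notMem (hT.ne_of_mem _ _ h1)).1 h1 (Finset.mem_filter.1 h2).2

theorem IsValidPartition.sum_card_filter {N C W : ℕ} {T : Finset (Fin N × Fin N)}
    {B : Fin W → RequestDigraph N} (hB : IsValidPartition C T B)
    (p : Fin N × Fin N → Prop) [DecidablePred p] :
    ∑ ω, ((B ω).arcs.filter p).card = (T.filter p).card := by
  rw [← Finset.card_biUnion]
  · congr 1
    ext r
    simp only [Finset.mem_biUnion, Finset.mem_univ, true_and, Finset.mem_filter]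
    constructor
    · rintro ⟨ω, h, hp⟩
      exact ⟨hB.arcs_subset ω h, hp⟩
    · rintro ⟨h, hp⟩
      obtain ⟨ω, hω, -⟩ := hB.existsUnique_mem r h
      exact ⟨ω, hω, hp⟩
  · intro ω _ ω' _ hne
    rw [Function.onFun, Finset.disjoint_left]
    intro r h1 h2
    have h1 := (Finset.mem_filter.1 h1).1
    exact hne ((hB.existsUnique_mem r (hB.arcs_subset ω h1)).unique h1 (Finset.mem_filter.1 h2).1)

/-- Every vertex of `T` has degree `N - 1`, so that for even `N` it has odd degree in some part of
the partition; the inequality for a single part is summed over all parts. -/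
theorem mul_le_four_mul_cost {N a : ℕ} (ha : a ∈ costs 3 N) :
    N * (N - 1 + (N - 1) % 2) ≤ 4 * a := by
  obtain ⟨T, hT, W, B, hB, rfl⟩ := ha
  have hsum : ∀ v, ∑ ω, deg (B ω).arcs v = N - 1 := by
    intro v
    rw [← hT.deg_eq v]
    simp only [deg, Finset.sum_add_distrib, outArcs, inArcs, hB.sum_card_filter]
  have hv : ∀ v, N - 1 + (N - 1) % 2 ≤ ∑ ω, (deg (B ω).arcs v + deg (B ω).arcs v % 2) := by
    intro v
    rw [Finset.sum_add_distrib, hsum v]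
    refine Nat.add_le_add_left ?_ _
    rw [← hsum v, Finset.sum_nat_mod]
    exact Nat.mod_le _ _
  calc N * (N - 1 + (N - 1) % 2) = ∑ _v : Fin N, (N - 1 + (N - 1) % 2) := by simp
    _ ≤ ∑ v, ∑ ω, (deg (B ω).arcs v + deg (B ω).arcs v % 2) :=
        Finset.sum_le_sum fun v _ => hv v
    _ = ∑ ω, ∑ v, (deg (B ω).arcs v + deg (B ω).arcs v % 2) := Finset.sum_comm
    _ ≤ ∑ ω, 4 * (B ω).verts.card := Finset.sum_le_sum fun ω _ =>
        sum_deg_add_mod_two_le (hB.admissible ω) fun r hr =>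
          hT.ne_of_mem _ _ (hB.arcs_subset ω hr)
    _ = 4 * ∑ ω, (B ω).verts.card := (Finset.mul_sum _ _ _).symm

/-! ### Steiner triple systems -/

/-- A Steiner quasigroup: for `x ≠ y`, the element `op x y` is the third point of the triple through
`x` and `y` of a Steiner triple system. -/
structure IsSteinerOp {V : Type*} (op : V → V → V) : Prop where
  idem : ∀ x, op x x = x
  comm : ∀ x y, op x y = op y x
  cancel : ∀ x y, op x (op x y) = y

theorem IsSteinerOp.conj {V W : Type*} {op : V → V → V} (h : IsSteinerOp op) (e : V ≃ W) :
    IsSteinerOp fun a b => e (op (e.symm a) (e.symm b)) where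
  idem x := by simp [h.idem]
  comm x y := by rw [h.comm]
  cancel x y := by simp [h.cancel]

theorem zmod_three_cases (i j : ZMod 3) : j = i ∨ j = i + 1 ∨ j = i + 2 := by
  revert i j
  decide

/-- The Bose construction of a Steiner triple system on `Q × ZMod 3`, for an abelian group `Q` in
which `half` is division by two: the triples are `{(x, 0), (x, 1), (x, 2)}` and
`{(x, i), (y, i), (half (x + y), i + 1)}` for `x ≠ y`. -/
def boseOp {Q : Type*} [AddCommGroup Q] [DecidableEq Q] (half : Q → Q) (p q : Q × ZMod 3) :
    Q × ZMod 3 :=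
  if p.1 = q.1 then (p.1, -(p.2 + q.2))
  else if q.2 = p.2 then (half (p.1 + q.1), p.2 + 1)
  else if q.2 = p.2 + 1 then (q.1 + q.1 - p.1, p.2)
  else (p.1 + p.1 - q.1, q.2)

theorem isSteinerOp_boseOp {Q : Type*} [AddCommGroup Q] [DecidableEq Q] {half : Q → Q}
    (h1 : ∀ x, half (x + x) = x) (h2 : ∀ x, half x + half x = x) :
    IsSteinerOp (boseOp half) := by
  have hinj : ∀ {x y : Q}, x + x = y + y → x = y := fun {x y} h => by rw [← h1 x, h, h1]
  have z1 : ∀ i : ZMod 3, -(i + i) = i := by decide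
  have z2 : ∀ i j : ZMod 3, -(i + -(i + j)) = j := by decide
  have z3 : ∀ i : ZMod 3, i + 1 ≠ i := by decide
  have z4 : ∀ i : ZMod 3, i + 2 ≠ i := by decide
  have z5 : ∀ i : ZMod 3, i + 2 ≠ i + 1 := by decide
  have z6 : ∀ i : ZMod 3, i + 1 + 1 ≠ i := by decide
  have z7 : ∀ i : ZMod 3, i + 2 + 1 = i := by decide
  refine ⟨?_, ?_, ?_⟩
  · rintro ⟨x, i⟩
    simp [boseOp, z1]
  · rintro ⟨x, i⟩ ⟨y, j⟩
    by_cases hxy : x = y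
    · simp [boseOp, hxy, add_comm i j]
    · have hyx : y ≠ x := Ne.symm hxy
      rcases zmod_three_cases i j with rfl | rfl | rfl
      · simp [boseOp, hxy, hyx, add_comm x y]
      · simp [boseOp, hxy, hyx, (z6 i).symm]
      · simp [boseOp, hxy, hyx, (z4 i).symm, z4 i, z5 i, z7 i]
  · rintro ⟨x, i⟩ ⟨y, j⟩
    by_cases hxy : x = y
    · simp only [boseOp, hxy, if_true, z2]
    · rcases zmod_three_cases i j with rfl | rfl | rfl
      · have h : x ≠ half (x + y) := fun e => hxy (add_left_cancel (a := x) (by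
          conv_lhs => rw [e]
          conv_lhs => rw [h2]))
        simp [boseOp, hxy, h, h2]
      · have h : x ≠ y + y - x := fun e => hxy (hinj (by
          conv_lhs => arg 2; rw [e]
          abel))
        simp [boseOp, hxy, h, h1]
      · have h : x ≠ x + x - y := fun e => hxy (by
          rw [add_sub_assoc, left_eq_add, sub_eq_zero] at e
          exact e)
        simp [boseOp, hxy, h, z4 i, z5 i]

/-- The third point of the triple through `(x, i)` and `(y, i + 1)` in the Skolem construction. -/
def skolemThird {Q : Type*} [AddCommGroup Q] [DecidableEq Q] (L : Q → Prop) [DecidablePred L]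
    (π : Equiv.Perm Q) (x y : Q) (i : ZMod 3) : Option (Q × ZMod 3) :=
  if π (x + x) = y then (if L x then some (x, i + 2) else none) else some (π.symm y - x, i)

/-- The Skolem construction of a Steiner triple system on `Q × ZMod 3` with one additional point
`none`. The operation `π (x + y)` on `Q` is half-idempotent: `π (x + x)` is `x` if `L x` holds
and `x + τ` otherwise, where `τ` has order two and translation by `τ` exchanges `L` with its
complement. The triples are `{(x, 0), (x, 1), (x, 2)}` for `L x`,
`{none, (x + τ, i), (x, i + 1)}` for `L x`, and `{(x, i), (y, i), (π (x + y), i + 1)}`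
for `x ≠ y`. -/
def skolemOp {Q : Type*} [AddCommGroup Q] [DecidableEq Q] (L : Q → Prop) [DecidablePred L]
    (τ : Q) (π : Equiv.Perm Q) : Option (Q × ZMod 3) → Option (Q × ZMod 3) → Option (Q × ZMod 3)
  | none, none => none
  | none, some (y, i) => some (y + τ, if L y then i + 2 else i + 1)
  | some (x, i), none => some (x + τ, if L x then i + 2 else i + 1)
  | some (x, i), some (y, j) =>
    if j = i then (if x = y then some (x, i) else some (π (x + y), i + 1))
    else if j = i + 1 then skolemThird L π x y i
    else skolemThird L π y x j

theorem isSteinerOp_skolemOp {Q : Type*} [AddCommGroup Q] [DecidableEq Q] {L : Q → Prop}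
    [DecidablePred L] {τ : Q} {π : Equiv.Perm Q} (hτ : τ + τ = 0) (hL : ∀ x, L (x + τ) ↔ ¬ L x)
    (h1 : ∀ x, L x → π (x + x) = x) (h2 : ∀ x, ¬ L x → π (x + x) = x + τ) :
    IsSteinerOp (skolemOp L τ π) := by
  have z4 : ∀ i : ZMod 3, i + 2 ≠ i := by decide
  have z5 : ∀ i : ZMod 3, i + 2 ≠ i + 1 := by decide
  have z7 : ∀ i : ZMod 3, i + 2 + 1 = i := by decide
  have z8 : ∀ i : ZMod 3, i + 1 + 2 = i := by decide
  have z9 : ∀ i : ZMod 3, i + 2 + 2 = i + 1 := by decide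
  have hττ : ∀ x, x + τ + τ = x := fun x => by rw [add_assoc, hτ, add_zero]
  have hdouble : ∀ x, x + τ + (x + τ) = x + x := fun x => by
    rw [add_add_add_comm, hτ, add_zero]
  -- the three forms of a product of two points other than `none`
  have e0 : ∀ x y i, x ≠ y → skolemOp L τ π (some (x, i)) (some (y, i)) =
      some (π (x + y), i + 1) := fun x y i h => by simp [skolemOp, h]
  have e1 : ∀ x y i, skolemOp L τ π (some (x, i)) (some (y, i + 1)) =
      skolemThird L π x y i := fun x y i => by simp [skolemOp]
  have e2 : ∀ x y i, skolemOp L τ π (some (x, i)) (some (y, i + 2)) =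
      skolemThird L π y x (i + 2) := fun x y i => by simp [skolemOp, z4 i, z5 i]
  refine ⟨?_, ?_, ?_⟩
  · rintro (_ | ⟨x, i⟩) <;> simp [skolemOp]
  · rintro (_ | ⟨x, i⟩) (_ | ⟨y, j⟩)
    · rfl
    · rfl
    · rfl
    · rcases zmod_three_cases i j with rfl | rfl | rfl
      · by_cases hxy : x = y
        · rw [hxy]
        · rw [e0 _ _ _ hxy, e0 _ _ _ (Ne.symm hxy), add_comm]
      · rw [e1]
        have := e2 y x (i + 1)
        rw [z8] at this
        exact this.symm
      · rw [e2]
        have := e1 y x (i + 2)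
        rw [z7] at this
        exact this.symm
  · rintro (_ | ⟨x, i⟩) (_ | ⟨y, j⟩)
    · rfl
    · by_cases hy : L y <;> simp [skolemOp, hy, hL, hττ, z7, z8]
    · by_cases hx : L x
      · have : skolemOp L τ π (some (x, i)) none = some (x + τ, i + 2) := by simp [skolemOp, hx]
        rw [this, e2]
        simp [skolemThird, hdouble, h1 x hx, hL, hx]
      · have : skolemOp L τ π (some (x, i)) none = some (x + τ, i + 1) := by simp [skolemOp, hx]
        rw [this, e1]
        simp [skolemThird, h2 x hx, hx]
    · rcases zmod_three_cases i j with rfl | rfl | rfl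
      · by_cases hxy : x = y
        · simp [skolemOp, hxy]
        · rw [e0 _ _ _ hxy, e1]
          simp [skolemThird, hxy]
      · rw [e1, skolemThird]
        by_cases hxx : π (x + x) = y
        · by_cases hx : L x
          · rw [if_pos hxx, if_pos hx, e2, skolemThird, if_pos (h1 x hx), if_pos hx, z9]
            rw [← hxx, h1 x hx]
          · rw [if_pos hxx, if_neg hx, ← hxx, h2 x hx]
            simp [skolemOp, hx]
        · rw [if_neg hxx, e0]
          · simp
          · intro e
            exact hxx (by rw [eq_sub_iff_add_eq] at e; simp [e])
      · rw [e2, skolemThird]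
        by_cases hyy : π (y + y) = x
        · by_cases hy : L y
          · have hyx : y = x := by rw [← hyy, h1 y hy]
            rw [if_pos hyy, if_pos hy, z9, e1, skolemThird, ← hyx, if_pos (h1 y hy), if_pos hy]
          · have hx : L x := by rw [← hyy, h2 y hy, hL]; exact hy
            rw [if_pos hyy, if_neg hy, ← hyy, h2 y hy]
            rw [← hyy, h2 y hy] at hx
            simp [skolemOp, hx, hττ]
        · rw [if_neg hyy, e2, skolemThird, if_neg]
          · simp
          · intro e
            refine hyy ?_
            rw [← Equiv.eq_symm_apply] at e ⊢
            have : π.symm x - y = y := by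
              have h := e
              nth_rewrite 3 [← sub_add_cancel (π.symm x) y] at h
              exact add_left_cancel h
            rw [sub_eq_iff_eq_add] at this
            exact this.symm

theorem exists_isSteinerOp_bose (t : ℕ) :
    ∃ op : Fin (6 * t + 3) → Fin (6 * t + 3) → Fin (6 * t + 3), IsSteinerOp op := by
  have ht : ((t : ZMod (2 * t + 1)) + 1) + (t + 1) = 1 := by
    have : ((2 * t + 1 : ℕ) : ZMod (2 * t + 1)) = 0 := ZMod.natCast_self _
    push_cast at this
    linear_combination this
  have h := isSteinerOp_boseOp (Q := ZMod (2 * t + 1)) (half := fun x => (t + 1) * x)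
    (fun x => by linear_combination x * ht) (fun x => by linear_combination x * ht)
  have hcard : Fintype.card (ZMod (2 * t + 1) × ZMod 3) = 6 * t + 3 := by
    rw [Fintype.card_prod, ZMod.card, ZMod.card]
    ring
  exact ⟨_, h.conj (Fintype.equivFinOfCardEq hcard)⟩

/-- The permutation `2 * k ↦ k`, `2 * k + 1 ↦ k + t` of the residues modulo `2 * t`. -/
def unshuffle (t : ℕ) : Equiv.Perm (Fin (2 * t)) where
  toFun x := ⟨if x.val % 2 = 0 then x.val / 2 else x.val / 2 + t, by
    have := x.isLt
    split_ifs <;> omega⟩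
  invFun y := ⟨if y.val < t then 2 * y.val else 2 * (y.val - t) + 1, by
    have := y.isLt
    split_ifs <;> omega⟩
  left_inv x := by
    have := x.isLt
    ext
    dsimp only
    split_ifs <;> omega
  right_inv y := by
    have := y.isLt
    ext
    dsimp only
    split_ifs <;> omega

theorem exists_isSteinerOp_skolem (t : ℕ) :
    ∃ op : Fin (6 * t + 1) → Fin (6 * t + 1) → Fin (6 * t + 1), IsSteinerOp op := by
  rcases Nat.eq_zero_or_pos t with rfl | ht
  · exact ⟨fun _ _ => 0, ⟨fun _ => Fin.ext (by omega), fun _ _ => rfl,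
      fun _ _ => Fin.ext (by omega)⟩⟩
  have : NeZero (2 * t) := ⟨by omega⟩
  have hval : ∀ x y : Fin (2 * t), (x + y).val =
      if x.val + y.val < 2 * t then x.val + y.val else x.val + y.val - 2 * t := by
    intro x y
    have hx := x.isLt
    have hy := y.isLt
    rw [Fin.val_add]
    split_ifs with h
    · exact Nat.mod_eq_of_lt h
    · rw [Nat.mod_eq_sub_mod (by omega), Nat.mod_eq_of_lt (by omega)]
  have h := isSteinerOp_skolemOp (Q := Fin (2 * t)) (L := fun x => x.val < t)
    (τ := ⟨t, by omega⟩) (π := unshuffle t) ?_ ?_ ?_ ?_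
  · have hcard : Fintype.card (Option (Fin (2 * t) × ZMod 3)) = 6 * t + 1 := by
      rw [Fintype.card_option, Fintype.card_prod, Fintype.card_fin, ZMod.card]
      ring
    exact ⟨_, h.conj (Fintype.equivFinOfCardEq hcard)⟩
  · ext
    rw [hval]
    simp only [Fin.val_zero]
    split_ifs <;> omega
  · intro x
    have := x.isLt
    simp only [hval]
    split_ifs <;> omega
  · intro x hx
    have := x.isLt
    ext
    simp only [unshuffle, Equiv.coe_fn_mk, hval]
    split_ifs <;> omega
  · intro x hx
    have := x.isLt
    ext
    simp only [unshuffle, Equiv.coe_fn_mk, hval]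
    split_ifs <;> omega

/-- A Steiner triple system on a finite set of points. -/
structure IsSteinerTripleSystem {V : Type*} (S : Finset (Finset V)) : Prop where
  card_eq_three : ∀ b ∈ S, b.card = 3
  existsUnique_mem : ∀ x y, x ≠ y → ∃! b, b ∈ S ∧ x ∈ b ∧ y ∈ b

theorem IsSteinerOp.exists_isSteinerTripleSystem {V : Type*} [Fintype V] [DecidableEq V]
    {op : V → V → V} (h : IsSteinerOp op) : ∃ S : Finset (Finset V), IsSteinerTripleSystem S := by
  have hcancel' : ∀ x y, op (op x y) y = x := fun x y => by
    rw [h.comm, h.comm x y, h.cancel]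
  have hne1 : ∀ x y, x ≠ y → x ≠ op x y := by
    intro x y hxy e
    apply hxy
    rw [← h.cancel x y, ← e, h.idem]
  have hne2 : ∀ x y, x ≠ y → y ≠ op x y := fun x y hxy => by
    rw [h.comm]
    exact hne1 y x hxy.symm
  refine ⟨(Finset.univ.filter fun p : V × V => p.1 ≠ p.2).image
    fun p => {p.1, p.2, op p.1 p.2}, ?_, ?_⟩
  · intro b hb
    obtain ⟨⟨x, y⟩, hp, rfl⟩ := Finset.mem_image.1 hb
    have hxy : x ≠ y := (Finset.mem_filter.1 hp).2
    exact Finset.card_eq_three.2 ⟨x, y, op x y, hxy, hne1 x y hxy, hne2 x y hxy, rfl⟩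
  · intro p q hpq
    refine ⟨{p, q, op p q}, ⟨Finset.mem_image.2 ⟨(p, q), by simpa using hpq, rfl⟩,
      by simp, by simp⟩, ?_⟩
    rintro b ⟨hb, hp, hq⟩
    obtain ⟨⟨x, y⟩, -, rfl⟩ := Finset.mem_image.1 hb
    have hxx := h.cancel x y
    have hyy := hcancel' x y
    have hc := h.comm
    simp only [Finset.mem_insert, Finset.mem_singleton] at hp hq
    ext z
    simp only [Finset.mem_insert, Finset.mem_singleton]
    rcases hp with rfl | rfl | rfl <;> rcases hq with rfl | rfl | rfl
    · exact absurd rfl hpq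
    · rfl
    · rw [hxx]; tauto
    · rw [hc q p]; tauto
    · exact absurd rfl hpq
    · rw [hc p, hyy]; tauto
    · rw [hc _ q, hxx]; tauto
    · rw [hyy]; tauto
    · exact absurd rfl hpq

theorem exists_isSteinerTripleSystem {v : ℕ} (hv : v % 6 = 1 ∨ v % 6 = 3) :
    ∃ S : Finset (Finset (Fin v)), IsSteinerTripleSystem S := by
  rcases hv with hv | hv
  · obtain ⟨t, rfl⟩ : ∃ t, v = 6 * t + 1 := ⟨v / 6, by omega⟩
    obtain ⟨op, h⟩ := exists_isSteinerOp_skolem t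
    exact h.exists_isSteinerTripleSystem
  · obtain ⟨t, rfl⟩ : ∃ t, v = 6 * t + 3 := ⟨v / 6, by omega⟩
    obtain ⟨op, h⟩ := exists_isSteinerOp_bose t
    exact h.exists_isSteinerTripleSystem

/-- Every point lies in `(v - 1) / 2` triples. -/
theorem IsSteinerTripleSystem.two_mul_card_filter {v : ℕ} {S : Finset (Finset (Fin v))}
    (hS : IsSteinerTripleSystem S) (x : Fin v) :
    2 * (S.filter fun b => x ∈ b).card = v - 1 := by
  have hunion : (S.filter fun b => x ∈ b).biUnion (fun b => b.erase x) = Finset.univ.erase x := by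
    ext y
    simp only [Finset.mem_biUnion, Finset.mem_filter, Finset.mem_erase, Finset.mem_univ, and_true]
    constructor
    · rintro ⟨b, -, h, -⟩
      exact h
    · intro h
      obtain ⟨b, ⟨hb, hy, hx⟩, -⟩ := hS.existsUnique_mem y x h
      exact ⟨b, ⟨hb, hx⟩, h, hy⟩
  have hcard := congrArg Finset.card hunion
  rw [Finset.card_erase_of_mem (Finset.mem_univ x), Finset.card_univ, Fintype.card_fin,
    Finset.card_biUnion, Finset.sum_const_nat (m := 2)] at hcard
  · omega
  · intro b hb
    obtain ⟨hb, hx⟩ := Finset.mem_filter.1 hb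
    rw [Finset.card_erase_of_mem hx, hS.card_eq_three b hb]
  · intro b hb b' hb' hne
    obtain ⟨hb, hx⟩ := Finset.mem_filter.1 hb
    obtain ⟨hb', hx'⟩ := Finset.mem_filter.1 hb'
    rw [Function.onFun, Finset.disjoint_left]
    intro y hy hy'
    obtain ⟨hyx, hy⟩ := Finset.mem_erase.1 hy
    exact hne ((hS.existsUnique_mem x y hyx.symm).unique ⟨hb, hx, hy⟩
      ⟨hb', hx', (Finset.mem_erase.1 hy').2⟩)

/-! ### The construction -/

/-- The tournament in which the diametral arcs are the arcs `(i, i + N / 2)` with `i < N / 2`. -/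
def canonicalTournament (N : ℕ) : Finset (Fin N × Fin N) :=
  Finset.univ.filter fun r =>
    r.1 ≠ r.2 ∧ (2 * dist r.1 r.2 < N ∨ (2 * dist r.1 r.2 = N ∧ r.1 < r.2))

theorem isRequestTournament_canonicalTournament (N : ℕ) :
    IsRequestTournament (canonicalTournament N) := by
  refine ⟨fun i j h => ?_, fun i j h => ?_, fun i j hne h => ?_, fun i j hne h => ?_⟩
  · exact (Finset.mem_filter.1 h).2.1
  · have := (Finset.mem_filter.1 h).2.2
    dsimp only at this
    omega
  · simp [canonicalTournament, hne, h]
  · have h2 : 2 * dist j i = N := by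
      have := dist_add_dist hne
      omega
    simp only [canonicalTournament, Finset.mem_filter, Finset.mem_univ, true_and, h, h2,
      lt_irrefl, false_or, hne, hne.symm, ne_eq, not_false_eq_true, not_lt]
    exact ⟨le_of_lt, fun hle => lt_of_le_of_ne hle hne⟩

/-- The coordinate of a vertex of the ring of length `N = 2 * m` or `N = 2 * m + 1`: vertices are
numbered from `1` to `2 * m`, with one additional vertex `0` when `N` is odd. -/
def coord (m : ℕ) {N : ℕ} (x : Fin N) : ℕ := x.val + (2 * m + 1) - N

/-- The class of a vertex: the vertices with coordinates `y` and `y + m`, for `1 ≤ y ≤ m`, form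
the class `y`, and the class `0` consists of the vertex with coordinate `0`, if there is one. -/
def vertexClass (m : ℕ) {N : ℕ} (x : Fin N) : Fin (m + 1) :=
  Fin.ofNat (m + 1) (if coord m x ≤ m then coord m x else coord m x - m)

/-- An arc is assigned to the pair formed by the classes of its two ends; if these coincide, the
second one is replaced by the class `0`. -/
def secondClass (m : ℕ) {N : ℕ} (r : Fin N × Fin N) : Fin (m + 1) :=
  if vertexClass m r.1 = vertexClass m r.2 then 0 else vertexClass m r.2

section Construction

variable {N m : ℕ}

theorem val_vertexClass (hN : N = 2 * m ∨ N = 2 * m + 1) (x : Fin N) :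
    (vertexClass m x).val = if coord m x ≤ m then coord m x else coord m x - m := by
  have := x.isLt
  rw [vertexClass, Fin.val_ofNat]
  refine Nat.mod_eq_of_lt ?_
  unfold coord
  rcases hN with rfl | rfl <;> split_ifs <;> omega

theorem val_secondClass (r : Fin N × Fin N) :
    (secondClass m r).val = if (vertexClass m r.1).val = (vertexClass m r.2).val then 0 else
      (vertexClass m r.2).val := by
  simp only [secondClass, ← Fin.ext_iff]
  split_ifs <;> rfl

theorem vertexClass_ne_secondClass (hN : N = 2 * m ∨ N = 2 * m + 1) {r : Fin N × Fin N}
    (hr : r.1 ≠ r.2) : vertexClass m r.1 ≠ secondClass m r := by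
  intro h
  have h := congrArg Fin.val h
  have hr : r.1.val ≠ r.2.val := fun e => hr (Fin.ext e)
  have h1 := val_vertexClass hN r.1
  have h2 := val_vertexClass hN r.2
  rw [val_secondClass] at h
  have := r.1.isLt
  have := r.2.isLt
  unfold coord at *
  split_ifs at * <;> omega

/-- The coordinates of the unique arc of the canonical tournament that is assigned to the pair of
classes `p < q` and passes over the ring arc leaving the vertex with coordinate `k` (for `p = 0`
and even `N`, where such an arc need not exist, it can only be `(q, q + m)`). -/
def arcOver (m N p q k : ℕ) : ℕ × ℕ :=
  if p = 0 then
    if N = 2 * m then (q, q + m)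
    else if k < q then (0, q)
    else if k < q + m then (q, q + m)
    else (q + m, 0)
  else if k < p then (q + m, p)
  else if k < q then (p, q)
  else if k < p + m then (q, p + m)
  else if k < q + m then (p + m, q + m)
  else (q + m, p)

set_option maxHeartbeats 2000000 in
theorem coord_eq_arcOver (hN : N = 2 * m ∨ N = 2 * m + 1) {r : Fin N × Fin N}
    (hr : r ∈ canonicalTournament N) {k : Fin N} (hk : dist r.1 k < dist r.1 r.2) {p q : ℕ}
    (hpq : p < q) (h : ((vertexClass m r.1).val = p ∧ (secondClass m r).val = q) ∨
      ((vertexClass m r.1).val = q ∧ (secondClass m r).val = p)) :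
    (coord m r.1, coord m r.2) = arcOver m N p q (coord m k) := by
  obtain ⟨i, j⟩ := r
  obtain ⟨hij, hT⟩ := (Finset.mem_filter.1 hr).2
  have hij : i.val ≠ j.val := fun e => hij (Fin.ext e)
  dsimp only at *
  rw [Fin.lt_def, dist_eq_ite] at hT
  rw [dist_eq_ite, dist_eq_ite] at hk
  rw [val_secondClass, val_vertexClass hN i, val_vertexClass hN j] at h
  have hi := i.isLt
  have hj := j.isLt
  have hk' := k.isLt
  -- the arc either stays within `0, …, N - 1` or wraps around
  have hpos : (i.val ≤ k.val ∧ k.val < j.val ∧ 2 * j.val ≤ 2 * i.val + N) ∨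
      (j.val < i.val ∧ (i.val ≤ k.val ∨ k.val < j.val) ∧ 2 * j.val + N < 2 * i.val) := by
    split_ifs at * <;> omega
  clear hk hT hr
  unfold coord at *
  generalize i.val = a at *
  generalize j.val = b at *
  generalize k.val = c at *
  rw [Prod.ext_iff]
  rcases hN with rfl | rfl
  · simp only [show ∀ x, x + (2 * m + 1) - 2 * m = x + 1 by omega] at h ⊢
    rcases hpos with hpos | hpos <;>
    rcases Nat.lt_or_ge m (a + 1) with ha | ha <;> rcases Nat.lt_or_ge m (b + 1) with hb | hb <;>
    simp only [ha, hb, Nat.not_le.2, if_true, if_false] at h <;>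
    split_ifs at h <;>
    rcases h with ⟨rfl, rfl⟩ | ⟨rfl, rfl⟩ <;>
    first
      | (exfalso; omega)
      | (unfold arcOver
         split_ifs <;> first | (exfalso; omega) | (constructor <;> dsimp only <;> omega))
  · simp only [Nat.add_sub_cancel] at h ⊢
    rcases hpos with hpos | hpos <;>
    rcases Nat.lt_or_ge m a with ha | ha <;> rcases Nat.lt_or_ge m b with hb | hb <;>
    simp only [ha, hb, Nat.not_le.2, if_true, if_false] at h <;>
    split_ifs at h <;>
    rcases h with ⟨rfl, rfl⟩ | ⟨rfl, rfl⟩ <;>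
    first
      | (exfalso; omega)
      | (unfold arcOver
         split_ifs <;> first | (exfalso; omega) | (constructor <;> dsimp only <;> omega))

theorem coord_injective (hN : N = 2 * m ∨ N = 2 * m + 1) :
    Function.Injective (coord m : Fin N → ℕ) := by
  intro x y h
  unfold coord at h
  ext
  omega

/-- The arcs assigned to a pair of classes are pairwise disjoint on the ring. -/
theorem eq_of_pair_eq (hN : N = 2 * m ∨ N = 2 * m + 1) {r r' : Fin N × Fin N}
    (hr : r ∈ canonicalTournament N) (hr' : r' ∈ canonicalTournament N) {k : Fin N}
    (hk : dist r.1 k < dist r.1 r.2) (hk' : dist r'.1 k < dist r'.1 r'.2)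
    (h : s(vertexClass m r.1, secondClass m r) = s(vertexClass m r'.1, secondClass m r')) :
    r = r' := by
  suffices (coord m r.1, coord m r.2) = (coord m r'.1, coord m r'.2) from
    Prod.ext (coord_injective hN (Prod.ext_iff.1 this).1)
      (coord_injective hN (Prod.ext_iff.1 this).2)
  have hne := vertexClass_ne_secondClass hN (Finset.mem_filter.1 hr).2.1
  rw [Sym2.eq_iff] at h
  rcases lt_or_gt_of_ne hne with hlt | hlt <;> rw [Fin.lt_def] at hlt
  · rw [coord_eq_arcOver hN hr hk hlt (Or.inl ⟨rfl, rfl⟩),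
      coord_eq_arcOver hN hr' hk' hlt]
    rcases h with ⟨h1, h2⟩ | ⟨h1, h2⟩
    · exact Or.inl ⟨by rw [h1], by rw [h2]⟩
    · exact Or.inr ⟨by rw [h2], by rw [h1]⟩
  · rw [coord_eq_arcOver hN hr hk hlt (Or.inr ⟨rfl, rfl⟩),
      coord_eq_arcOver hN hr' hk' hlt]
    rcases h with ⟨h1, h2⟩ | ⟨h1, h2⟩
    · exact Or.inr ⟨by rw [h1], by rw [h2]⟩
    · exact Or.inl ⟨by rw [h2], by rw [h1]⟩

/-- The digraph of a triple `b` of classes: its vertices are those with class in `b`, and its arcs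
those whose assigned pair is contained in `b`. The condition on the class of the second end is then
automatic (`mem_arcs_tripleDigraph`); it is included to make the incidence condition immediate. -/
def tripleDigraph (N m : ℕ) (b : Finset (Fin (m + 1))) : RequestDigraph N where
  verts := Finset.univ.filter fun x => vertexClass m x ∈ b
  arcs := (canonicalTournament N).filter fun r => vertexClass m r.1 ∈ b ∧ secondClass m r ∈ b ∧
    vertexClass m r.2 ∈ b
  incidence r hr := by
    have h := (Finset.mem_filter.1 hr).2
    exact ⟨Finset.mem_filter.2 ⟨Finset.mem_univ _, h.1⟩,
      Finset.mem_filter.2 ⟨Finset.mem_univ _, h.2.2⟩⟩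

theorem mem_arcs_tripleDigraph {b : Finset (Fin (m + 1))} {r : Fin N × Fin N} :
    r ∈ (tripleDigraph N m b).arcs ↔
      r ∈ canonicalTournament N ∧ vertexClass m r.1 ∈ b ∧ secondClass m r ∈ b := by
  rw [tripleDigraph, Finset.mem_filter]
  refine and_congr_right fun _ => ⟨fun h => ⟨h.1, h.2.1⟩, fun h => ⟨h.1, h.2, ?_⟩⟩
  have h2 := h.2
  rw [secondClass] at h2
  split_ifs at h2 with heq
  · exact heq ▸ h.1
  · exact h2

/-- Each of the three pairs of classes contained in `b` contributes at most one to the load. -/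
theorem admissible_tripleDigraph (hN : N = 2 * m ∨ N = 2 * m + 1) {b : Finset (Fin (m + 1))}
    (hb : b.card = 3) : Admissible 3 (tripleDigraph N m b) := by
  intro e he
  obtain ⟨k, -, rfl⟩ := Finset.mem_image.1 he
  have hcard : (b.offDiag.image Sym2.mk.uncurry).card = 3 := by
    rw [Sym2.card_image_offDiag, hb]
    rfl
  rw [load, ← hcard]
  refine Finset.card_le_card_of_injOn (fun r => s(vertexClass m r.1, secondClass m r)) ?_ ?_
  · intro r hr
    have hr := mem_arcs_tripleDigraph.1 (Finset.mem_filter.1 hr).1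
    exact Finset.mem_image.2 ⟨(vertexClass m r.1, secondClass m r), Finset.mem_offDiag.2
      ⟨hr.2.1, hr.2.2, vertexClass_ne_secondClass hN (Finset.mem_filter.1 hr.1).2.1⟩, rfl⟩
  · intro r hr r' hr' h
    have hr := Finset.mem_filter.1 hr
    have hr' := Finset.mem_filter.1 hr'
    exact eq_of_pair_eq hN (mem_arcs_tripleDigraph.1 hr.1).1 (mem_arcs_tripleDigraph.1 hr'.1).1
      (dist_lt_of_mem_route hr.2) (dist_lt_of_mem_route hr'.2) h

/-- The cost of the construction: every vertex lies in the digraphs of the `m / 2` triples through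
its class. -/
theorem exists_mem_costs (hN : N = 2 * m ∨ N = 2 * m + 1) {S : Finset (Finset (Fin (m + 1)))}
    (hS : IsSteinerTripleSystem S) : ∃ a ∈ costs 3 N, 2 * a = N * m := by
  refine ⟨_, ⟨canonicalTournament N, isRequestTournament_canonicalTournament N, S.card,
    fun ω => tripleDigraph N m (S.equivFin.symm ω).1, ⟨?_, ?_, ?_⟩, rfl⟩, ?_⟩
  · intro ω r hr
    exact (mem_arcs_tripleDigraph.1 hr).1
  · intro r hr
    obtain ⟨b, ⟨hbS, hb⟩, huniq⟩ := hS.existsUnique_mem _ _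
      (vertexClass_ne_secondClass hN (Finset.mem_filter.1 hr).2.1)
    refine ⟨S.equivFin ⟨b, hbS⟩, ?_, fun ω hω => ?_⟩
    · simpa [mem_arcs_tripleDigraph] using ⟨hr, hb⟩
    · rw [← Equiv.symm_apply_eq]
      exact Subtype.ext (huniq _ ⟨(S.equivFin.symm ω).2, (mem_arcs_tripleDigraph.1 hω).2⟩)
  · exact fun ω => admissible_tripleDigraph hN (hS.card_eq_three _ (S.equivFin.symm ω).2)
  · have h1 : ∑ ω, (tripleDigraph N m (S.equivFin.symm ω).1).verts.card =
        ∑ b ∈ S, (tripleDigraph N m b).verts.card := by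
      rw [Equiv.sum_comp S.equivFin.symm fun b : S => (tripleDigraph N m b.1).verts.card,
        Finset.sum_coe_sort S fun b => (tripleDigraph N m b).verts.card]
    have h2 : ∑ b ∈ S, (tripleDigraph N m b).verts.card =
        ∑ x : Fin N, (S.filter fun b => vertexClass m x ∈ b).card := by
      simp only [tripleDigraph, Finset.card_filter]
      exact Finset.sum_comm
    rw [h1, h2, Finset.mul_sum]
    simp [hS.two_mul_card_filter]

end Construction

/-- If `m + 1` is the order of a Steiner triple system, the lower bound and the construction
agree. -/
theorem four_mul_A {N m : ℕ} (hN : N = 2 * m ∨ N = 2 * m + 1)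
    (hm : (m + 1) % 6 = 1 ∨ (m + 1) % 6 = 3) : 4 * A 3 N = 2 * (N * m) := by
  obtain ⟨S, hS⟩ := exists_isSteinerTripleSystem hm
  obtain ⟨a, ha, ha'⟩ := exists_mem_costs hN hS
  have hA := isLeast_A (C := 3) (by norm_num) N
  have hle := hA.2 ha
  have hge := mul_le_four_mul_cost hA.1
  have hdeg : N * (N - 1 + (N - 1) % 2) = 2 * (N * m) := by
    rcases Nat.eq_zero_or_pos N with rfl | hpos
    · simp
    · rw [show N - 1 + (N - 1) % 2 = 2 * m by omega]
      ring
  omega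

end RingGrooming

theorem mainTheorem5 (N : ℕ) :
    ((N ≡ 0 [MOD 12] ∨ N ≡ 4 [MOD 12]) →
      (RingGrooming.A 3 N : ℚ) = (N : ℚ) ^ 2 / 4) ∧
    ((N ≡ 1 [MOD 12] ∨ N ≡ 5 [MOD 12]) →
      (RingGrooming.A 3 N : ℚ) = (N : ℚ) * ((N : ℚ) - 1) / 4) := by
  simp only [Nat.ModEq]
  constructor
  · intro h
    obtain ⟨m, rfl⟩ : ∃ m, N = 2 * m := ⟨N / 2, by omega⟩
    have h4 := RingGrooming.four_mul_A (N := 2 * m) (m := m) (Or.inl rfl) (by omega)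
    have h4' : (4 : ℚ) * RingGrooming.A 3 (2 * m) = 2 * (2 * m * m) := by exact_mod_cast h4
    push_cast
    linarith
  · intro h
    obtain ⟨m, rfl⟩ : ∃ m, N = 2 * m + 1 := ⟨N / 2, by omega⟩
    have h4 := RingGrooming.four_mul_A (N := 2 * m + 1) (m := m) (Or.inr rfl) (by omega)
    have h4' : (4 : ℚ) * RingGrooming.A 3 (2 * m + 1) = 2 * ((2 * m + 1) * m) := by
      exact_mod_cast h4
    push_cast
    linarith
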